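/- Let $X$ be a complex Hilbert space and let $A$ (with domain $D(A)\subset X$) generate an exponentially stable strongly continuous semigroup $(T(t))_{t\ge 0}$ on $X$, i.e. $\|T(t)\|\le M_0e^{-\omega t}$ for all $t\ge 0$ and some constants $M_0$ and $\omega>0$; let $A^*$ be the adjoint of $A$, which generates the adjoint semigroup $(T(t)^*)_{t\ge0}$. Let $(-A)^{1/2}$ be the inverse, defined on its range, of the bounded injective operator $(-A)^{-1/2}x=\pi^{-1/2}\int_0^\infty t^{-1/2}T(t)x\,dt$, and let $(-A^*)^{1/2}$ be defined in the same way from $(T(t)^*)_{t\ge0}$. Assume that $(-A)^{1/2}$ is an (infinite-time) admissible output operator for $(T(t))_{t\ge 0}$, i.e. $(-A)^{1/2}T(\cdot)x\in L^2((0,\infty),X)$ for all $x\in D(A)$ and there is a constant $m_1$ such that $$\int_0^\infty \|(-A)^{1/2}T(t)x\|^2\,dt\le m_1\|x\|^2\qquad (x\in D(A)),$$ and that $(-A^*)^{1/2}$ is admissible for $(T(t)^*)_{t\ge 0}$, i.e. $(-A^*)^{1/2}T(\cdot)^*y\in L^2((0,\infty),X)$ for all $y\in D(A^*)$ and there is a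 constant $m_2$ such that $$\int_0^\infty \|(-A^*)^{1/2}T(t)^*y\|^2\,dt\le m_2\|y\|^2\qquad (y\in D(A^*)).$$ Then there is a constant $M$ such that for every $t>0$ one has $T(t)X\subset D(A)$ and $\|AT(t)\|\le M/t$. Moreover, $A$ generates a bounded analytic semigroup: there are $\delta\in(0,\pi/2]$ and bounded operators $S(z)$ on $X$ for $z=0$ and for $z$ in the sector $\Sigma_\delta=\{z\in\mathbb C\setminus\{0\}:|\arg z|<\delta\}$ such that $S(0)=I$, $S(z+w)=S(z)S(w)$ for $z,w\in\Sigma_\delta$, the map $z\mapsto S(z)$ is analytic in $\Sigma_\delta$, for every $\delta'\in(0,\delta)$ one has $S(z)x\to x$ as $z\to0$ in $\Sigma_{\delta'}$ for all $x\in X$ and $\sup_{z\in\Sigma_{\delta'}}\|S(z)\|<\infty$, and $A$ is the generator of $(S(t))_{t\ge 0}$. -/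

import Mathlib

open MeasureTheory Set Filter Topology

section

variable {X Y : Type*} [NormedAddCommGroup X] [InnerProductSpace ℂ X]
  [NormedAddCommGroup Y] [InnerProductSpace ℂ Y]

/-- A strongly continuous semigroup `(T(t))_{t ≥ 0}` of bounded operators on `X`.
Only the values `T t` with `0 ≤ t` matter, here and in everything below. -/
structure IsC0Semigroup (T : ℝ → X →L[ℂ] X) : Prop where
  map_zero : T 0 = ContinuousLinearMap.id ℂ X
  map_add : ∀ s t : ℝ, 0 ≤ s → 0 ≤ t → T (s + t) = (T s).comp (T t)
  continuousOn : ∀ x : X, ContinuousOn (fun t : ℝ => T t x) (Ici 0)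

/-- Exponential stability: `‖T(t)‖ ≤ M e^{-ωt}` for all `t ≥ 0`, for some `M` and some `ω > 0`. -/
def IsExponentiallyStable (T : ℝ → X →L[ℂ] X) : Prop :=
  ∃ M ω : ℝ, 0 < ω ∧ ∀ t : ℝ, 0 ≤ t → ‖T t‖ ≤ M * Real.exp (-(ω * t))

/-- `A` is the infinitesimal generator of `T`: `x ∈ D(A)` and `A x = y` if and only if
`(T(h) x - x) / h → y` as `h ↓ 0`. -/
def IsGenerator (A : X →ₗ.[ℂ] X) (T : ℝ → X →L[ℂ] X) : Prop :=
  ∀ x y : X, (x, y) ∈ A.graph ↔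
    Tendsto (fun h : ℝ => h⁻¹ • (T h x - x)) (𝓝[>] 0) (𝓝 y)

/-- The operator `(-A)^{-1/2} y = π^{-1/2} ∫_0^∞ t^{-1/2} T(t) y dt`, where `A` is the generator
of `T`. Its domain consists of all `y` for which the integral converges absolutely, which is all
of `X` if `T` is an exponentially stable strongly continuous semigroup. -/
noncomputable def negGenInvSqrt (T : ℝ → X →L[ℂ] X) : X →ₗ.[ℂ] X where
  domain :=
    { carrier := {y | IntegrableOn (fun t : ℝ => t ^ (-(1 / 2) : ℝ) • T t y) (Ioi 0)}
      zero_mem' := by simp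
      add_mem' := by
        intro a b ha hb
        have h := Integrable.add ha hb
        refine h.congr (Eventually.of_forall fun t => ?_)
        simp
      smul_mem' := by
        intro c a ha
        have h := Integrable.smul c ha
        refine h.congr (Eventually.of_forall fun t => ?_)
        simp [smul_comm c] }
  toFun :=
    { toFun := fun y => (√Real.pi)⁻¹ • ∫ t in Ioi (0 : ℝ), t ^ (-(1 / 2) : ℝ) • T t (y : X)
      map_add' := by
        intro a b
        have h := integral_add a.2 b.2
        rw [← smul_add, ← h]
        simp
      map_smul' := by
        intro c a
        have h := integral_smul (μ := volume.restrict (Ioi (0 : ℝ))) c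
          (fun t : ℝ => t ^ (-(1 / 2) : ℝ) • T t (a : X))
        rw [RingHom.id_apply, smul_comm c, ← h]
        simp [smul_comm c] }

/-- The square root `(-A)^{1/2}`, where `A` is the generator of the exponentially stable
semigroup `T`: the inverse of the injective operator `(-A)^{-1/2}`, defined on its range. -/
noncomputable def negGenSqrt (T : ℝ → X →L[ℂ] X) : X →ₗ.[ℂ] X :=
  (negGenInvSqrt T).inverse

/-- `C` is an (infinite-time) admissible output operator for the semigroup `T` with generator `A`:
for each `x ∈ D(A)` the function `f = C T(·) x` is everywhere defined on `[0,∞)` (at `t = 0` this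
says that `C` is defined on `D(A)`), it belongs to `L²((0,∞), Y)`, and
`∫_0^∞ ‖C T(t) x‖² dt ≤ m ‖x‖²` with `m` independent of `x`. -/
def IsAdmissible (T : ℝ → X →L[ℂ] X) (A : X →ₗ.[ℂ] X) (C : X →ₗ.[ℂ] Y) : Prop :=
  ∃ m : ℝ, ∀ x ∈ A.domain, ∃ f : ℝ → Y,
    (∀ t : ℝ, 0 ≤ t → (T t x, f t) ∈ C.graph) ∧
    MemLp f 2 (volume.restrict (Ioi 0)) ∧
    ∫ t in Ioi (0 : ℝ), ‖f t‖ ^ 2 ≤ m * ‖x‖ ^ 2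

/-- The open sector `{z ≠ 0 : |arg z| < δ}`. -/
def openSector (δ : ℝ) : Set ℂ := {z | z ≠ 0 ∧ |z.arg| < δ}

/-- `(S(z))`, `z ∈ Σ_δ ∪ {0}`, is a bounded analytic semigroup of angle `δ ∈ (0, π/2]`.
Only the values `S z` with `z` in the sector or `z = 0` matter. -/
structure IsBoundedAnalyticSemigroup (δ : ℝ) (S : ℂ → X →L[ℂ] X) : Prop where
  angle_pos : 0 < δ
  angle_le : δ ≤ Real.pi / 2
  map_zero : S 0 = ContinuousLinearMap.id ℂ X
  map_add : ∀ z ∈ openSector δ, ∀ w ∈ openSector δ, S (z + w) = (S z).comp (S w)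
  analytic : DifferentiableOn ℂ S (openSector δ)
  tendsto_zero : ∀ δ' : ℝ, 0 < δ' → δ' < δ → ∀ x : X,
    Tendsto (fun z : ℂ => S z x) (𝓝[openSector δ'] 0) (𝓝 x)
  bounded : ∀ δ' : ℝ, 0 < δ' → δ' < δ → ∃ K : ℝ, ∀ z ∈ openSector δ', ‖S z‖ ≤ K

/-- `A` generates a bounded analytic semigroup: `A` is the generator of the restriction to
`[0,∞)` of a bounded analytic semigroup of some angle `δ ∈ (0, π/2]`. -/
def GeneratesBoundedAnalyticSemigroup (A : X →ₗ.[ℂ] X) : Prop :=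
  ∃ (δ : ℝ) (S : ℂ → X →L[ℂ] X),
    IsBoundedAnalyticSemigroup δ S ∧ IsGenerator A (fun t : ℝ => S (t : ℂ))

end

/-! ### Orbit integrals and the operator `K = (-A)⁻¹`. -/

section Semigroup

variable {X : Type*} [NormedAddCommGroup X] [InnerProductSpace ℂ X] {T : ℝ → X →L[ℂ] X}

/-! Let `K = (-A)⁻¹` and `B = (-A)^{-1/2}`, so that `B²` is a positive multiple `c` of `K`. Put
`f(s) = (-A)^{1/2} T(s) K w` and `g(s) = (-A*)^{1/2} T(s)* K* v`. Splitting `T(t) = T(s) T(t-s)` and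
sharing `K` between the two factors gives `⟨K* v, T(t) w⟩ = c ⟨g(s), f(t-s)⟩` for every `s ∈ [0,t]`.
The left side does not depend on `s`; integrating over `[0,t]` produces the factor `t`, and the two
admissibility bounds control the right side by `‖K w‖²` and `‖K* v‖²`. Density of the range of `K*`
and a scaling argument then give `t ‖T(t) w‖ ≤ C ‖K w‖`, which is `‖A T(t)‖ ≤ C/t`
(`IsNegInverseGenerator.mul_norm_le_of_isAdmissible`).

Analyticity follows classically: `AⁿT(t) = (A T(t/n))ⁿ` has norm at most `(Cn/t)ⁿ`, and `nⁿ/n! ≤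
eⁿ`, so the Taylor series of `T` at `t` converges on a disc of radius proportional to `t`
(`IsNegInverseGenerator.exists_isAnalyticDerivFamily`). These discs cover a sector, the sums agree
on overlaps (`IsAnalyticDerivFamily.sum_eq_sum`), and the semigroup law is a Cauchy product
(`IsAnalyticDerivFamily.sum_mul_sum`). -/

lemma IsExponentiallyStable.exists_pos_bound (hstab : IsExponentiallyStable T) :
    ∃ M ω : ℝ, 1 ≤ M ∧ 0 < ω ∧ ∀ t : ℝ, 0 ≤ t → ‖T t‖ ≤ M * Real.exp (-(ω * t)) := by
  obtain ⟨M, ω, hω, h⟩ := hstab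
  refine ⟨max M 1, ω, le_max_right _ _, hω, fun t ht => (h t ht).trans ?_⟩
  gcongr
  exact le_max_left _ _

lemma IsC0Semigroup.map_add_apply (hT : IsC0Semigroup T) {s t : ℝ} (hs : 0 ≤ s) (ht : 0 ≤ t)
    (x : X) : T (s + t) x = T s (T t x) := by
  rw [hT.map_add s t hs ht]; rfl

lemma IsC0Semigroup.comm_apply (hT : IsC0Semigroup T) {s t : ℝ} (hs : 0 ≤ s) (ht : 0 ≤ t)
    (x : X) : T s (T t x) = T t (T s x) := by
  rw [← hT.map_add_apply hs ht, ← hT.map_add_apply ht hs, add_comm]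

lemma IsC0Semigroup.tendsto_zero (hT : IsC0Semigroup T) (x : X) :
    Tendsto (fun t : ℝ => T t x) (𝓝[>] 0) (𝓝 x) := by
  have h := hT.continuousOn x 0 self_mem_Ici
  rw [ContinuousWithinAt, hT.map_zero] at h
  exact h.mono_left (nhdsWithin_mono _ Ioi_subset_Ici_self)

lemma setIntegral_Ioi_comp_add_right {E : Type*} [NormedAddCommGroup E] [NormedSpace ℝ E]
    (f : ℝ → E) (a b : ℝ) : ∫ t in Ioi a, f (t + b) = ∫ t in Ioi (a + b), f t := by
  have h := (measurePreserving_add_right volume b).setIntegral_preimage_emb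
    (measurableEmbedding_addRight b) f (Ioi (a + b))
  simpa using h

/-- Weighted integrals `∫_0^∞ t^s T(t) x dt` converge absolutely for `s > -1`. -/
lemma IsC0Semigroup.integrableOn_rpow_smul (hT : IsC0Semigroup T)
    (hstab : IsExponentiallyStable T) {s : ℝ} (hs : -1 < s) (x : X) :
    IntegrableOn (fun t : ℝ => t ^ s • T t x) (Ioi 0) := by
  obtain ⟨M, ω, hM, hω, hb⟩ := hstab.exists_pos_bound
  have h1 := (integrableOn_rpow_mul_exp_neg_mul_rpow hs one_pos hω).const_mul (M * ‖x‖)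
  refine Integrable.mono' h1 ?_ ?_
  · refine ContinuousOn.aestronglyMeasurable ?_ measurableSet_Ioi
    have h : ContinuousOn (fun t : ℝ => t ^ s) (Ioi 0) := fun t ht =>
      (Real.continuousAt_rpow_const t s (Or.inl (ne_of_gt ht))).continuousWithinAt
    exact h.smul ((hT.continuousOn x).mono Ioi_subset_Ici_self)
  · refine (ae_restrict_iff' measurableSet_Ioi).2 (Eventually.of_forall fun t ht => ?_)
    have ht' : 0 < t := ht
    rw [norm_smul, Real.norm_of_nonneg (by positivity), Real.rpow_one, neg_mul]
    calc t ^ s * ‖T t x‖ ≤ t ^ s * ((M * Real.exp (-(ω * t))) * ‖x‖) := by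
          gcongr; exact (T t).le_of_opNorm_le (hb t ht'.le) x
      _ = _ := by ring

lemma IsC0Semigroup.exists_rpowIntegral (hT : IsC0Semigroup T)
    (hstab : IsExponentiallyStable T) {s : ℝ} (hs : -1 < s) :
    ∃ J : X →L[ℂ] X, ∀ x, J x = ∫ t in Ioi (0 : ℝ), t ^ s • T t x := by
  obtain ⟨M, ω, hM, hω, hb⟩ := hstab.exists_pos_bound
  have h1 := integrableOn_rpow_mul_exp_neg_mul_rpow hs one_pos hω
  refine ⟨LinearMap.mkContinuous
    { toFun := fun x => ∫ t in Ioi (0 : ℝ), t ^ s • T t x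
      map_add' := fun x y => ?_
      map_smul' := fun c x => ?_ }
    (∫ t in Ioi (0 : ℝ), M * (t ^ s * Real.exp (-ω * t ^ (1 : ℝ)))) fun x => ?_, fun x => rfl⟩
  · rw [← integral_add (hT.integrableOn_rpow_smul hstab hs x)
      (hT.integrableOn_rpow_smul hstab hs y)]
    simp
  · rw [RingHom.id_apply, ← integral_smul]
    simp [smul_comm c]
  · rw [← integral_mul_const]
    refine norm_integral_le_of_norm_le ((h1.const_mul M).mul_const _) ?_
    refine (ae_restrict_iff' measurableSet_Ioi).2 (Eventually.of_forall fun t ht => ?_)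
    have ht' : 0 < t := ht
    rw [norm_smul, Real.norm_of_nonneg (by positivity), Real.rpow_one, neg_mul]
    calc t ^ s * ‖T t x‖ ≤ t ^ s * ((M * Real.exp (-(ω * t))) * ‖x‖) := by
          gcongr; exact (T t).le_of_opNorm_le (hb t ht'.le) x
      _ = _ := by ring

/-- `K` is the negative `(-A)⁻¹ = ∫_0^∞ T(t) dt` of the inverse of the generator of `T`. -/
structure IsNegInverseGenerator (T : ℝ → X →L[ℂ] X) (K : X →L[ℂ] X) : Prop where
  comm : ∀ t : ℝ, 0 ≤ t → ∀ x, T t (K x) = K (T t x)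
  apply_eq : ∀ t : ℝ, 0 ≤ t → ∀ x, T t (K x) = K x - ∫ s in (0 : ℝ)..t, T s x

/-- Both properties come from `T(t) K x = ∫_t^∞ T(s) x ds`. -/
lemma IsC0Semigroup.isNegInverseGenerator [CompleteSpace X] (hT : IsC0Semigroup T)
    (hstab : IsExponentiallyStable T) {K : X →L[ℂ] X}
    (hK : ∀ x, K x = ∫ t in Ioi (0 : ℝ), T t x) : IsNegInverseGenerator T K := by
  have hint : ∀ x, IntegrableOn (fun t : ℝ => T t x) (Ioi 0) := fun x => by
    simpa using hT.integrableOn_rpow_smul hstab (s := 0) (by norm_num) x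
  have hcomm : ∀ t : ℝ, 0 ≤ t → ∀ x, T t (K x) = ∫ s in Ioi (0 : ℝ), T (s + t) x := by
    intro t ht x
    rw [hK, ← ContinuousLinearMap.integral_comp_comm _ (hint x)]
    refine setIntegral_congr_fun measurableSet_Ioi fun s hs => ?_
    have hs' : (0 : ℝ) ≤ s := le_of_lt hs
    simp only [add_comm s t, hT.map_add_apply ht hs']
  constructor
  · intro t ht x
    rw [hcomm t ht, hK]
    refine setIntegral_congr_fun measurableSet_Ioi fun s hs => ?_
    have hs' : (0 : ℝ) ≤ s := le_of_lt hs
    simp only [hT.map_add_apply hs' ht]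
  · intro t ht x
    rw [hcomm t ht, hK, setIntegral_Ioi_comp_add_right (fun s => T s x), zero_add,
      ← intervalIntegral.integral_interval_add_Ioi (hint x)
        ((hint x).mono_set (Ioi_subset_Ioi ht))]
    abel

end Semigroup

/-! ### `K` as the negative inverse of the generator, and its square root. -/

section Semigroup

variable {X : Type*} [NormedAddCommGroup X] [InnerProductSpace ℂ X]
  {T : ℝ → X →L[ℂ] X} {K : X →L[ℂ] X} {A : X →ₗ.[ℂ] X}

namespace IsNegInverseGenerator

variable [CompleteSpace X]

lemma hasDerivAt (hK : IsNegInverseGenerator T K) (hT : IsC0Semigroup T) {t : ℝ} (ht : 0 < t)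
    (x : X) : HasDerivAt (fun s => T s (K x)) (-(T t x)) t := by
  have hc := (hT.continuousOn x).mono Ioi_subset_Ici_self
  have hint : IntervalIntegrable (fun s => T s x) volume 0 t :=
    ContinuousOn.intervalIntegrable
      ((hT.continuousOn x).mono (by rw [uIcc_of_le ht.le]; exact Icc_subset_Ici_self))
  have h := (intervalIntegral.integral_hasDerivAt_right hint
    (hc.stronglyMeasurableAtFilter isOpen_Ioi t ht)
    (hc.continuousAt (Ioi_mem_nhds ht))).const_sub (K x)
  refine h.congr_of_eventuallyEq ?_
  filter_upwards [Ioi_mem_nhds ht] with s hs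
  exact hK.apply_eq s (le_of_lt hs) x

lemma tendsto_slope (hK : IsNegInverseGenerator T K) (hT : IsC0Semigroup T) (x : X) :
    Tendsto (fun h : ℝ => h⁻¹ • (T h (K x) - K x)) (𝓝[>] 0) (𝓝 (-x)) := by
  have hc := hT.continuousOn x
  have h0 : HasDerivWithinAt (fun u => ∫ s in (0 : ℝ)..u, T s x) (T 0 x) (Ioi 0) 0 :=
    (intervalIntegral.integral_hasDerivWithinAt_right (by simp) (s := Ici 0) (t := Ioi 0)
      ((hc.mono Ioi_subset_Ici_self).stronglyMeasurableAtFilter_nhdsWithin measurableSet_Ioi 0)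
      ((hc 0 self_mem_Ici).mono Ioi_subset_Ici_self)).mono Ioi_subset_Ici_self
  rw [hasDerivWithinAt_iff_tendsto_slope' (by simp), hT.map_zero] at h0
  refine (h0.neg).congr' ?_
  filter_upwards [self_mem_nhdsWithin] with h hh
  rw [hK.apply_eq h (le_of_lt hh) x, slope_def_module]
  simp

lemma injective (hK : IsNegInverseGenerator T K) (hT : IsC0Semigroup T) :
    Function.Injective K := by
  refine (injective_iff_map_eq_zero K).2 fun x hx => ?_
  have h := hK.tendsto_slope hT x
  simp only [hx, map_zero, sub_zero, smul_zero] at h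
  exact neg_eq_zero.1 (tendsto_nhds_unique h tendsto_const_nhds)

/-- Every `x` is the limit of difference quotients of `T(·) K(-x)`, and these lie in the range of
`K` because `K` commutes with `T`. -/
lemma denseRange (hK : IsNegInverseGenerator T K) (hT : IsC0Semigroup T) : DenseRange K := by
  intro x
  have h := hK.tendsto_slope hT (-x)
  rw [neg_neg] at h
  refine mem_closure_of_tendsto h ?_
  filter_upwards [self_mem_nhdsWithin] with t ht
  rw [hK.comm t (le_of_lt ht), ← map_sub]
  exact ⟨(t⁻¹ : ℝ) • (T t (-x) - -x), by simp⟩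

/-- This is `A = -K⁻¹`. If `A x = y`, applying `K` to the difference quotients of `T(·) x` gives the
limit `K y`, while `tendsto_slope` gives `-x`. -/
lemma mem_graph_iff (hK : IsNegInverseGenerator T K) (hT : IsC0Semigroup T)
    (hA : IsGenerator A T) (x y : X) : (x, y) ∈ A.graph ↔ x = K (-y) := by
  rw [hA]
  constructor
  · intro h
    have h1 : Tendsto (fun h : ℝ => h⁻¹ • (T h (K x) - K x)) (𝓝[>] 0) (𝓝 (K y)) := by
      refine ((K.continuous.tendsto y).comp h).congr' ?_
      filter_upwards [self_mem_nhdsWithin] with t ht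
      simp [hK.comm t (le_of_lt ht)]
    have h2 := tendsto_nhds_unique h1 (hK.tendsto_slope hT x)
    rw [map_neg, h2, neg_neg]
  · rintro rfl
    simpa using hK.tendsto_slope hT (-y)

lemma denseRange_adjoint (hK : IsNegInverseGenerator T K) (hT : IsC0Semigroup T) :
    DenseRange (ContinuousLinearMap.adjoint K) := by
  have h : (ContinuousLinearMap.adjoint K).range.topologicalClosure = ⊤ := by
    rw [← K.orthogonal_ker, LinearMap.ker_eq_bot.2 (hK.injective hT)]
    simp
  exact (Submodule.dense_iff_topologicalClosure_eq_top.2 h :)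

end IsNegInverseGenerator

/-- The value is `π`, but only its positivity is needed. -/
lemma integral_rpow_div_one_add_pos :
    0 < ∫ u in Ioi (0 : ℝ), u ^ (-(1 / 2) : ℝ) * (1 + u)⁻¹ := by
  have h := Real.integral_rpowIntegrand₀₁_one_pos (p := 1 / 2) (by constructor <;> norm_num)
  refine h.trans_eq (setIntegral_congr_fun measurableSet_Ioi fun u hu => ?_)
  simp only [Real.rpowIntegrand₀₁_eq_pow_div (p := 1 / 2) (by constructor <;> norm_num)
    (le_of_lt hu) zero_le_one]
  norm_num [div_eq_mul_inv, add_comm]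

lemma integrableOn_rpow_div_one_add :
    IntegrableOn (fun u : ℝ => u ^ (-(1 / 2) : ℝ) * (1 + u)⁻¹) (Ioi 0) := by
  have h := Real.integrableOn_rpowIntegrand₀₁_Ioi (p := 1 / 2) (x := 1)
    (by constructor <;> norm_num) zero_le_one
  refine h.congr_fun (fun u hu => ?_) measurableSet_Ioi
  simp only [Real.rpowIntegrand₀₁_eq_pow_div (p := 1 / 2) (by constructor <;> norm_num)
    (le_of_lt hu) zero_le_one]
  norm_num [div_eq_mul_inv, add_comm]

lemma integrable_rpow_mul_exp_prod {ω : ℝ} (hω : 0 < ω) :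
    Integrable (fun p : ℝ × ℝ => p.2 ^ (-(1 / 2) : ℝ) * Real.exp (-(ω * (p.1 * (1 + p.2)))))
      ((volume.restrict (Ioi (0 : ℝ))).prod (volume.restrict (Ioi (0 : ℝ)))) := by
  have hm : AEStronglyMeasurable
      (fun p : ℝ × ℝ => p.2 ^ (-(1 / 2) : ℝ) * Real.exp (-(ω * (p.1 * (1 + p.2)))))
      ((volume.restrict (Ioi (0 : ℝ))).prod (volume.restrict (Ioi (0 : ℝ)))) := by
    refine Measurable.aestronglyMeasurable ?_
    fun_prop
  have hi : ∀ u : ℝ, 0 < u → IntegrableOn (fun t : ℝ => Real.exp (-(ω * (1 + u)) * t)) (Ioi 0) :=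
    fun u hu => exp_neg_integrableOn_Ioi 0 (by positivity)
  rw [integrable_prod_iff' hm]
  constructor
  · refine (ae_restrict_iff' measurableSet_Ioi).2 (Eventually.of_forall fun u hu => ?_)
    refine ((hi u hu).const_mul (u ^ (-(1 / 2) : ℝ))).congr (Eventually.of_forall fun t => ?_)
    dsimp only
    congr 2
    ring
  · refine (integrableOn_rpow_div_one_add.const_mul ω⁻¹).congr
      ((ae_restrict_iff' measurableSet_Ioi).2 (Eventually.of_forall fun u hu => ?_))
    have hu' : 0 < u := hu
    have h1 : ∀ t : ℝ, ‖u ^ (-(1 / 2) : ℝ) * Real.exp (-(ω * (t * (1 + u))))‖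
        = u ^ (-(1 / 2) : ℝ) * Real.exp (-(ω * (1 + u)) * t) := fun t => by
      rw [Real.norm_of_nonneg (by positivity)]
      congr 2
      ring
    simp only [h1]
    rw [integral_const_mul, integral_exp_mul_Ioi (by nlinarith)]
    simp
    ring

lemma IsC0Semigroup.integrable_rpow_smul_prod (hT : IsC0Semigroup T)
    (hstab : IsExponentiallyStable T) (x : X) :
    Integrable (fun p : ℝ × ℝ => p.2 ^ (-(1 / 2) : ℝ) • T (p.1 * (1 + p.2)) x)
      ((volume.restrict (Ioi (0 : ℝ))).prod (volume.restrict (Ioi (0 : ℝ)))) := by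
  obtain ⟨M, ω, hM, hω, hb⟩ := hstab.exists_pos_bound
  refine Integrable.mono' ((integrable_rpow_mul_exp_prod hω).const_mul (M * ‖x‖)) ?_ ?_
  · rw [Measure.prod_restrict]
    refine ContinuousOn.aestronglyMeasurable ?_ (measurableSet_Ioi.prod measurableSet_Ioi)
    have h1 : ContinuousOn (fun p : ℝ × ℝ => p.2 ^ (-(1 / 2) : ℝ)) (Ioi 0 ×ˢ Ioi 0) := fun p hp =>
      ((Real.continuousAt_rpow_const p.2 _ (Or.inl (ne_of_gt hp.2))).comp
        continuousAt_snd).continuousWithinAt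
    have h2 : ContinuousOn (fun p : ℝ × ℝ => T (p.1 * (1 + p.2)) x) (Ioi 0 ×ˢ Ioi 0) :=
      (hT.continuousOn x).comp (f := fun p : ℝ × ℝ => p.1 * (1 + p.2)) (by fun_prop)
        fun p hp => by
          have h1 : 0 < p.1 := hp.1
          have h2 : 0 < p.2 := hp.2
          exact (by positivity : 0 ≤ p.1 * (1 + p.2))
    exact h1.smul h2
  · rw [Measure.prod_restrict]
    refine (ae_restrict_iff' (measurableSet_Ioi.prod measurableSet_Ioi)).2
      (Eventually.of_forall fun p hp => ?_)
    have h1 : 0 < p.1 := hp.1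
    have h2 : 0 < p.2 := hp.2
    rw [norm_smul, Real.norm_of_nonneg (by positivity)]
    calc p.2 ^ (-(1 / 2) : ℝ) * ‖T (p.1 * (1 + p.2)) x‖
        ≤ p.2 ^ (-(1 / 2) : ℝ) * ((M * Real.exp (-(ω * (p.1 * (1 + p.2))))) * ‖x‖) := by
          gcongr; exact (T _).le_of_opNorm_le (hb _ (by positivity)) x
      _ = _ := by ring

variable [CompleteSpace X] in
/-- `∫_0^∞ t^{-1/2} T(t) dt` squares to a positive multiple of `∫_0^∞ T(t) dt`. -/
lemma IsC0Semigroup.rpowIntegral_comp_self (hT : IsC0Semigroup T)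
    (hstab : IsExponentiallyStable T) {J K : X →L[ℂ] X}
    (hJ : ∀ x, J x = ∫ t in Ioi (0 : ℝ), t ^ (-(1 / 2) : ℝ) • T t x)
    (hK : ∀ x, K x = ∫ t in Ioi (0 : ℝ), T t x) (x : X) :
    J (J x) = (∫ u in Ioi (0 : ℝ), u ^ (-(1 / 2) : ℝ) * (1 + u)⁻¹) • K x := by
  have hint := hT.integrableOn_rpow_smul hstab (s := -(1 / 2)) (by norm_num) x
  calc J (J x) = ∫ t in Ioi (0 : ℝ), ∫ u in Ioi (0 : ℝ),
        u ^ (-(1 / 2) : ℝ) • T (t * (1 + u)) x := by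
        rw [hJ (J x)]
        refine setIntegral_congr_fun measurableSet_Ioi fun t ht => ?_
        have ht' : 0 < t := ht
        have h1 : T t (J x) = ∫ s in Ioi (0 : ℝ), s ^ (-(1 / 2) : ℝ) • T (t + s) x := by
          rw [hJ, ← ContinuousLinearMap.integral_comp_comm _ hint]
          refine setIntegral_congr_fun measurableSet_Ioi fun s hs => ?_
          have hs' : (0 : ℝ) ≤ s := le_of_lt hs
          simp [hT.map_add_apply ht'.le hs']
        -- Substituting `s = t u` turns `s^{-1/2} ds` into `t^{1/2} u^{-1/2} du`, which cancels the
        -- outer weight `t^{-1/2}`.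
        have h2 := integral_comp_mul_left_Ioi'
          (fun s => s ^ (-(1 / 2) : ℝ) • T (t + s) x) 0 ht'
        rw [mul_zero] at h2
        simp only [h1]
        rw [← h2, smul_smul, ← integral_smul]
        refine setIntegral_congr_fun measurableSet_Ioi fun u hu => ?_
        have hu' : 0 < u := hu
        have h3 : t ^ (-(1 / 2) : ℝ) * t * (t * u) ^ (-(1 / 2) : ℝ) = u ^ (-(1 / 2) : ℝ) := by
          rw [Real.mul_rpow ht'.le hu'.le, ← mul_assoc]
          have : t ^ (-(1 / 2) : ℝ) * t * t ^ (-(1 / 2) : ℝ) = 1 := by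
            rw [mul_right_comm, ← Real.rpow_add ht', ← Real.rpow_add_one ht'.ne']
            norm_num
          rw [this, one_mul]
        simp only [smul_smul]
        rw [h3, mul_add, mul_one]
    _ = ∫ u in Ioi (0 : ℝ), ∫ t in Ioi (0 : ℝ), u ^ (-(1 / 2) : ℝ) • T (t * (1 + u)) x :=
        integral_integral_swap (hT.integrable_rpow_smul_prod hstab x)
    _ = ∫ u in Ioi (0 : ℝ), (u ^ (-(1 / 2) : ℝ) * (1 + u)⁻¹) • K x := by
        refine setIntegral_congr_fun measurableSet_Ioi fun u hu => ?_
        have hu' : 0 < u := hu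
        have h1 := integral_comp_mul_right_Ioi (fun t => T t x) 0 (b := 1 + u) (by positivity)
        rw [integral_smul, h1, zero_mul, ← hK, smul_smul]
    _ = _ := integral_smul_const _ _

end Semigroup

/-! ### From admissibility to the bound on `A T(t)`. -/

section Admissible

variable {X : Type*} [NormedAddCommGroup X] [InnerProductSpace ℂ X]
  {T : ℝ → X →L[ℂ] X} {A : X →ₗ.[ℂ] X}

/-- The graph of a partial inverse is the swapped graph only when the kernel is trivial; injectivity
of `B` supplies this. -/
lemma eq_apply_of_mem_negGenSqrt_graph {B : X →L[ℂ] X} (hB : Function.Injective B)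
    (h : ∀ z : (negGenInvSqrt T).domain, negGenInvSqrt T z = B z) {x y : X}
    (hxy : (x, y) ∈ (negGenSqrt T).graph) : x = B y := by
  have hker : (negGenInvSqrt T).toFun.ker = ⊥ := by
    refine LinearMap.ker_eq_bot'.2 fun z hz => Subtype.ext (hB ?_)
    rw [← h z]
    simpa using hz
  rw [negGenSqrt, LinearPMap.inverse_graph hker] at hxy
  obtain ⟨⟨a, b⟩, hab, he⟩ := hxy
  simp only [LinearEquiv.coe_coe, LinearEquiv.prodComm_apply, Prod.swap_prod_mk,
    Prod.mk.injEq] at he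
  obtain ⟨rfl, rfl⟩ := he
  obtain ⟨z, rfl, hz⟩ := (LinearPMap.mem_graph_iff _).1 hab
  rw [← h z]
  exact hz.symm

/-- Strong continuity of the adjoint semigroup is not required: integrability of its weighted orbit
is part of `z` lying in the domain, and this lets the inner product pass under both integrals. -/
lemma negGenInvSqrt_adjoint_apply [CompleteSpace X] (hT : IsC0Semigroup T)
    (hstab : IsExponentiallyStable T)
    {B : X →L[ℂ] X}
    (hB : ∀ x, B x = (√Real.pi)⁻¹ • ∫ t in Ioi (0 : ℝ), t ^ (-(1 / 2) : ℝ) • T t x)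
    (z : (negGenInvSqrt (fun t => ContinuousLinearMap.adjoint (T t))).domain) :
    negGenInvSqrt (fun t => ContinuousLinearMap.adjoint (T t)) z
      = ContinuousLinearMap.adjoint B z := by
  refine ext_inner_left ℂ fun w => ?_
  have hz : IntegrableOn (fun t : ℝ => t ^ (-(1 / 2) : ℝ) •
    ContinuousLinearMap.adjoint (T t) (z : X)) (Ioi 0) := z.2
  have hw := hT.integrableOn_rpow_smul hstab (s := -(1 / 2)) (by norm_num) w
  change inner ℂ w ((√Real.pi)⁻¹ • ∫ t in Ioi (0 : ℝ), t ^ (-(1 / 2) : ℝ) •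
    ContinuousLinearMap.adjoint (T t) (z : X)) = _
  rw [ContinuousLinearMap.adjoint_inner_right, hB, inner_smul_right_eq_smul,
    inner_smul_left_eq_smul, ← integral_inner hz, ← inner_conj_symm (∫ t in Ioi (0 : ℝ), _) (z : X),
    ← integral_inner hw, ← integral_conj]
  congr 1
  refine integral_congr_ae (Eventually.of_forall fun t => ?_)
  simp only [inner_conj_symm]
  rw [inner_smul_right_eq_smul, inner_smul_left_eq_smul, ContinuousLinearMap.adjoint_inner_right]

/-- For `x ∈ D(A)` one has `x = -K A x`, hence `⟨K* v, A x⟩ = ⟨-v, x⟩`. -/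
lemma IsNegInverseGenerator.adjoint_mem_adjoint_domain [CompleteSpace X] {K : X →L[ℂ] X}
    (hK : IsNegInverseGenerator T K) (hT : IsC0Semigroup T) (hA : IsGenerator A T) (v : X) :
    ContinuousLinearMap.adjoint K v ∈ A.adjoint.domain := by
  refine A.mem_adjoint_domain_of_exists _ ⟨-v, fun x => ?_⟩
  have h := (hK.mem_graph_iff hT hA x (A x)).1 (A.mem_graph x)
  rw [ContinuousLinearMap.adjoint_inner_left]
  nth_rewrite 1 [h]
  simp

omit [InnerProductSpace ℂ X] in
lemma integrableOn_norm_sq {f : ℝ → X} (hf : MemLp f 2 (volume.restrict (Ioi 0))) :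
    IntegrableOn (fun s => ‖f s‖ ^ 2) (Ioi 0) :=
  hf.integrable_norm_pow two_ne_zero

omit [InnerProductSpace ℂ X] in
/-- If `C` is bounded along the pairings of `g(s)` and `f(t - s)`, then `t C` is controlled
by the `L²`-norms of `f` and `g`. -/
lemma mul_le_of_le_norm_mul_norm {f g : ℝ → X} (hf : MemLp f 2 (volume.restrict (Ioi 0)))
    (hg : MemLp g 2 (volume.restrict (Ioi 0))) {C t : ℝ} (ht : 0 < t)
    (hC : ∀ s ∈ Icc 0 t, C ≤ ‖g s‖ * ‖f (t - s)‖) :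
    t * C ≤ (∫ s in Ioi (0 : ℝ), ‖f s‖ ^ 2) + ∫ s in Ioi (0 : ℝ), ‖g s‖ ^ 2 := by
  have hfi := integrableOn_norm_sq hf
  have hgi := integrableOn_norm_sq hg
  have hle : ∀ h : ℝ → X, IntegrableOn (fun s => ‖h s‖ ^ 2) (Ioi 0) →
      ∫ s in (0 : ℝ)..t, ‖h s‖ ^ 2 ≤ ∫ s in Ioi (0 : ℝ), ‖h s‖ ^ 2 := fun h hh => by
    rw [intervalIntegral.integral_of_le ht.le]
    exact setIntegral_mono_set hh (Eventually.of_forall fun s => by positivity)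
      (Eventually.of_forall fun s hs => hs.1)
  have hii : ∀ h : ℝ → X, IntegrableOn (fun s => ‖h s‖ ^ 2) (Ioi 0) →
      IntervalIntegrable (fun s => ‖h s‖ ^ 2) volume 0 t := fun h hh => by
    rw [intervalIntegrable_iff_integrableOn_Ioc_of_le ht.le]
    exact hh.mono_set fun s hs => hs.1
  have hfr : IntervalIntegrable (fun s => ‖f (t - s)‖ ^ 2) volume 0 t := by
    have h := (hii f hfi).comp_sub_left t
    simpa using h.symm
  calc t * C = ∫ s in (0 : ℝ)..t, C := by simp
    _ ≤ ∫ s in (0 : ℝ)..t, (‖f (t - s)‖ ^ 2 + ‖g s‖ ^ 2) := by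
        refine intervalIntegral.integral_mono_on ht.le (by simp) (hfr.add (hii g hgi))
          fun s hs => (hC s hs).trans ?_
        nlinarith [sq_nonneg (‖g s‖ - ‖f (t - s)‖), sq_nonneg (‖g s‖ + ‖f (t - s)‖)]
    _ = (∫ s in (0 : ℝ)..t, ‖f s‖ ^ 2) + ∫ s in (0 : ℝ)..t, ‖g s‖ ^ 2 := by
        rw [intervalIntegral.integral_add hfr (hii g hgi),
          intervalIntegral.integral_comp_sub_left (fun s => ‖f s‖ ^ 2)]
        simp
    _ ≤ _ := add_le_add (hle f hfi) (hle g hgi)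

lemma mul_norm_le_of_forall_inner_le {x : X} {a b p t : ℝ} (ha : 0 ≤ a) (hb : 0 ≤ b)
    (hp : 0 < p) (h : ∀ u : X, t * ‖inner ℂ u x‖ ≤ a * p ^ 2 + b * ‖u‖ ^ 2) : t * ‖x‖ ≤ (a + b) * p := by
  rcases eq_or_ne x 0 with rfl | hx
  · simp only [norm_zero, mul_zero]
    positivity
  · have hq : 0 < ‖x‖ := norm_pos_iff.2 hx
    -- Testing with the multiple of `x` of norm `p` makes both terms on the right multiples of `p²`.
    have h1 := h (((p / ‖x‖ : ℝ) : ℂ) • x)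
    have h2 : ‖(((p / ‖x‖ : ℝ) : ℂ) • x)‖ = p := by
      rw [norm_smul, Complex.norm_real, Real.norm_of_nonneg (by positivity)]
      field_simp
    have h3 : ‖inner ℂ (((p / ‖x‖ : ℝ) : ℂ) • x) x‖ = p * ‖x‖ := by
      rw [inner_smul_left, norm_mul, inner_self_eq_norm_sq_to_K, RCLike.norm_conj,
        Complex.norm_real, Real.norm_of_nonneg (by positivity)]
      simp
      field_simp
    rw [h2, h3] at h1
    refine le_of_mul_le_mul_left ?_ hp
    linarith

/-- With `x = K w` this reads `t ‖A T(t) x‖ ≤ M ‖x‖` for `x ∈ D(A)`. -/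
theorem IsNegInverseGenerator.mul_norm_le_of_isAdmissible [CompleteSpace X] {K : X →L[ℂ] X}
    (hT : IsC0Semigroup T) (hA : IsGenerator A T) (hstab : IsExponentiallyStable T)
    (hKi : ∀ x, K x = ∫ t in Ioi (0 : ℝ), T t x)
    (hadm : IsAdmissible T A (negGenSqrt T))
    (hadm_adj : IsAdmissible (fun t : ℝ => ContinuousLinearMap.adjoint (T t)) A.adjoint
      (negGenSqrt (fun t : ℝ => ContinuousLinearMap.adjoint (T t)))) :
    ∃ M : ℝ, 0 ≤ M ∧ ∀ t : ℝ, 0 < t → ∀ w : X, t * ‖T t w‖ ≤ M * ‖K w‖ := by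
  have hK := hT.isNegInverseGenerator hstab hKi
  obtain ⟨J, hJ⟩ := hT.exists_rpowIntegral hstab (s := -(1 / 2)) (by norm_num)
  set c₀ : ℝ := ∫ u in Ioi (0 : ℝ), u ^ (-(1 / 2) : ℝ) * (1 + u)⁻¹ with hc₀
  set r : ℝ := (√Real.pi)⁻¹ with hr
  have hr0 : 0 < r := by positivity
  set c : ℝ := r * (r * c₀) with hc
  have hc0 : 0 < c := mul_pos hr0 (mul_pos hr0 integral_rpow_div_one_add_pos)
  have hc0' : (c : ℂ) ≠ 0 := by exact_mod_cast hc0.ne'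
  set B : X →L[ℂ] X := (r : ℂ) • J with hBdef
  have hB : ∀ x, B x = r • ∫ t in Ioi (0 : ℝ), t ^ (-(1 / 2) : ℝ) • T t x := fun x => by
    rw [hBdef, _root_.smul_apply, hJ, Complex.coe_smul]
  have hBB : ∀ x, B (B x) = (c : ℂ) • K x := fun x => by
    simp only [hBdef, _root_.smul_apply, map_smul]
    rw [hT.rpowIntegral_comp_self hstab hJ hKi x, ← hc₀, ← Complex.coe_smul c₀, smul_smul,
      smul_smul, hc]
    push_cast
    ring_nf
  set B' := ContinuousLinearMap.adjoint B with hB'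
  set K' := ContinuousLinearMap.adjoint K with hK'
  have hBB' : ∀ x, B' (B' x) = (c : ℂ) • K' x := fun x => by
    refine ext_inner_right ℂ fun y => ?_
    rw [ContinuousLinearMap.adjoint_inner_left, ContinuousLinearMap.adjoint_inner_left, hBB,
      inner_smul_left, inner_smul_right, ContinuousLinearMap.adjoint_inner_left,
      Complex.conj_ofReal]
  have hBinj : Function.Injective B := (injective_iff_map_eq_zero B).2 fun x hx => by
    have h := hBB x
    rw [hx, map_zero, eq_comm, smul_eq_zero_iff_right hc0'] at h
    exact (injective_iff_map_eq_zero K).1 (hK.injective hT) x h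
  have hK'inj : ∀ x, K' x = 0 → x = 0 := fun x hx => by
    refine (hK.denseRange hT).eq_zero_of_inner_left ℂ ?_
    intro y
    rw [← ContinuousLinearMap.adjoint_inner_left, hx, inner_zero_left]
  have hBinj' : Function.Injective B' := (injective_iff_map_eq_zero B').2 fun x hx => by
    have h := hBB' x
    rw [hx, map_zero, eq_comm, smul_eq_zero_iff_right hc0'] at h
    exact hK'inj x h
  have hBT : ∀ t : ℝ, 0 ≤ t → ∀ x, B (T t x) = T t (B x) := fun t ht x => by
    rw [hB, hB, ← Complex.coe_smul, ← Complex.coe_smul, map_smul,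
      ← ContinuousLinearMap.integral_comp_comm _
        (hT.integrableOn_rpow_smul hstab (s := -(1 / 2)) (by norm_num) x)]
    congr 1
    refine setIntegral_congr_fun measurableSet_Ioi fun s hs => ?_
    have hs' : (0 : ℝ) ≤ s := le_of_lt hs
    simp [hT.comm_apply ht hs']
  obtain ⟨m₁, hm₁⟩ := hadm
  obtain ⟨m₂, hm₂⟩ := hadm_adj
  have key : ∀ t : ℝ, 0 < t → ∀ w v : X,
      t * ‖inner ℂ (K' v) (T t w)‖ ≤ c * |m₁| * ‖K w‖ ^ 2 + c * |m₂| * ‖K' v‖ ^ 2 := by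
    intro t ht w v
    have hmem : K w ∈ A.domain :=
      LinearPMap.mem_domain_of_mem_graph ((hK.mem_graph_iff hT hA (K w) (-w)).2 (by simp))
    obtain ⟨f, hfT, hfL, hfm⟩ := hm₁ _ hmem
    obtain ⟨g, hgT, hgL, hgm⟩ := hm₂ _ (hK.adjoint_mem_adjoint_domain hT hA v)
    have hf : ∀ s, 0 ≤ s → (c : ℂ) • f s = T s (B w) := fun s hs => by
      have h := eq_apply_of_mem_negGenSqrt_graph hBinj (fun z => (hB z).symm) (hfT s hs)
      refine hBinj ?_
      rw [map_smul, ← h, ← map_smul, ← hBB, hBT s hs]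
    have hg : ∀ s, 0 ≤ s → B' (g s) = ContinuousLinearMap.adjoint (T s) (K' v) := fun s hs =>
      (eq_apply_of_mem_negGenSqrt_graph hBinj'
        (negGenInvSqrt_adjoint_apply hT hstab hB) (hgT s hs)).symm
    -- `T(s)* K* v = B* g(s)`; moving `B*` across, `B T(t-s) w = T(t-s) B w = c f(t-s)`.
    have hpair : ∀ s ∈ Icc 0 t, ‖inner ℂ (K' v) (T t w)‖ ≤ c * (‖g s‖ * ‖f (t - s)‖) := by
      intro s hs
      have hts : 0 ≤ t - s := sub_nonneg.2 hs.2
      have h1 : inner ℂ (K' v) (T t w) = (c : ℂ) * inner ℂ (g s) (f (t - s)) := by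
        rw [← inner_smul_right, hf _ hts, ← hBT _ hts, ← ContinuousLinearMap.adjoint_inner_left B,
          ← hB', hg s hs.1, ContinuousLinearMap.adjoint_inner_left (T s), ← hT.map_add_apply hs.1 hts,
          add_sub_cancel]
      rw [h1, norm_mul, Complex.norm_real, Real.norm_of_nonneg hc0.le]
      gcongr
      exact norm_inner_le_norm _ _
    have h := mul_le_of_le_norm_mul_norm hfL hgL (C := c⁻¹ * ‖inner ℂ (K' v) (T t w)‖) ht
      fun s hs => by
        rw [inv_mul_le_iff₀ hc0]
        exact hpair s hs
    have h1 := mul_le_mul_of_nonneg_right (le_abs_self m₁) (sq_nonneg ‖K w‖)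
    have h2 := mul_le_mul_of_nonneg_right (le_abs_self m₂) (sq_nonneg ‖K' v‖)
    have h3 : t * (c⁻¹ * ‖inner ℂ (K' v) (T t w)‖) ≤ |m₁| * ‖K w‖ ^ 2 + |m₂| * ‖K' v‖ ^ 2 := by
      linarith
    calc t * ‖inner ℂ (K' v) (T t w)‖ = c * (t * (c⁻¹ * ‖inner ℂ (K' v) (T t w)‖)) := by
          field_simp
      _ ≤ c * (|m₁| * ‖K w‖ ^ 2 + |m₂| * ‖K' v‖ ^ 2) := by gcongr
      _ = _ := by ring
  refine ⟨c * |m₁| + c * |m₂|, by positivity, fun t ht w => ?_⟩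
  rcases eq_or_ne w 0 with rfl | hw
  · simp
  refine mul_norm_le_of_forall_inner_le (by positivity) (by positivity) (norm_pos_iff.2 fun h => hw ?_) fun u => ?_
  · exact (injective_iff_map_eq_zero K).1 (hK.injective hT) w h
  · refine (hK.denseRange_adjoint hT).induction_on (p := fun u => t * ‖inner ℂ u (T t w)‖ ≤
      c * |m₁| * ‖K w‖ ^ 2 + c * |m₂| * ‖u‖ ^ 2) u ?_ (key t ht w)
    exact isClosed_le (by fun_prop) (by fun_prop)

end Admissible

/-! ### The derivatives `AⁿT(t)` and their Cauchy estimates. -/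

section Derivatives

variable {X : Type*} [NormedAddCommGroup X] [InnerProductSpace ℂ X]
  {T : ℝ → X →L[ℂ] X} {K : X →L[ℂ] X}

/-- `D n t = T⁽ⁿ⁾(t) = Aⁿ T(t)` for `t > 0`, with the Cauchy-type estimates
`‖D n t‖ (ρ t)ⁿ / n! ≤ M 2⁻ⁿ` of an analytic semigroup. -/
structure IsAnalyticDerivFamily (T : ℝ → X →L[ℂ] X) (K : X →L[ℂ] X) (D : ℕ → ℝ → X →L[ℂ] X)
    (M ρ : ℝ) : Prop where
  radius_pos : 0 < ρ
  zero : ∀ t : ℝ, D 0 t = T t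
  succ_apply_inv : ∀ n : ℕ, ∀ t : ℝ, 0 < t → ∀ x, D (n + 1) t (K x) = -D n t x
  add : ∀ m n : ℕ, ∀ s t : ℝ, 0 < s → 0 < t → D (m + n) (s + t) = D m s * D n t
  hasDerivAt : ∀ n : ℕ, ∀ t : ℝ, 0 < t → ∀ x, HasDerivAt (fun s => D n s x) (D (n + 1) t x) t
  bound : ∀ n : ℕ, ∀ t : ℝ, 0 < t → (ρ * t) ^ n / n.factorial * ‖D n t‖ ≤ M * (1 / 2) ^ n

/-- `G t` plays the role of `-A T(t)`: the estimate lets `T(t) K⁻¹` extend from the dense range of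
`K`. -/
lemma exists_apply_inv_eq [CompleteSpace X] (hd : DenseRange K) {C : ℝ} (hC : 0 ≤ C)
    (h : ∀ t : ℝ, 0 < t → ∀ w : X, t * ‖T t w‖ ≤ C * ‖K w‖) :
    ∃ G : ℝ → X →L[ℂ] X, ∀ t : ℝ, 0 < t → (∀ x, G t (K x) = T t x) ∧ ‖G t‖ ≤ C / t := by
  have hb : ∀ t : ℝ, 0 < t → ∀ w : X,
      ‖(T t).toLinearMap w‖ ≤ C / t * ‖K.toLinearMap w‖ := fun t ht w => by
    rw [div_mul_eq_mul_div, le_div_iff₀ ht, mul_comm]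
    exact h t ht w
  exact ⟨fun t => (T t).toLinearMap.extendOfNorm K.toLinearMap, fun t ht =>
    ⟨LinearMap.extendOfNorm_eq hd ⟨_, hb t ht⟩,
      LinearMap.opNorm_extendOfNorm_le hd (by positivity) (hb t ht)⟩⟩

lemma ContinuousLinearMap.denseRange_pow (hd : DenseRange K) (n : ℕ) : DenseRange (K ^ n) := by
  induction n with
  | zero => simpa using Function.surjective_id.denseRange
  | succ n ih =>
    rw [pow_succ]
    exact ih.comp hd (K ^ n).continuous

/-- Reduces identities between the operators `AⁿT(t)` to the range of `Kⁿ`, where they become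
identities of the semigroup. -/
lemma ContinuousLinearMap.ext_of_denseRange_pow (hd : DenseRange K) (n : ℕ) {P Q : X →L[ℂ] X}
    (h : ∀ x, P ((K ^ n) x) = Q ((K ^ n) x)) : P = Q :=
  DFunLike.coe_injective
    ((denseRange_pow hd n).equalizer P.continuous Q.continuous (funext h))

lemma IsNegInverseGenerator.comm_pow (hK : IsNegInverseGenerator T K) {t : ℝ} (ht : 0 ≤ t)
    (n : ℕ) (x : X) : T t ((K ^ n) x) = (K ^ n) (T t x) := by
  induction n generalizing x with
  | zero => simp
  | succ n ih => simp only [pow_succ, mul_apply_eq_comp, ih, hK.comm t ht]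

lemma IsNegInverseGenerator.neg_pow_apply_pow (hK : IsNegInverseGenerator T K)
    (hT : IsC0Semigroup T) {G : X →L[ℂ] X} {s : ℝ} (hs : 0 ≤ s) (hG : ∀ x, G (K x) = T s x)
    (n : ℕ) (x : X) : ((-G) ^ n) ((K ^ n) x) = (-1 : ℂ) ^ n • T (n * s) x := by
  induction n generalizing x with
  | zero => simp [hT.map_zero]
  | succ n ih =>
    rw [pow_succ, pow_succ', mul_apply_eq_comp, mul_apply_eq_comp,
      _root_.neg_apply, hG, map_neg, hK.comm_pow hs, ih,
      ← hT.map_add_apply (by positivity) hs, pow_succ]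
    push_cast
    rw [add_mul, one_mul, mul_neg, mul_one, neg_smul]

lemma IsNegInverseGenerator.exists_isAnalyticDerivFamily [CompleteSpace X]
    (hK : IsNegInverseGenerator T K) (hT : IsC0Semigroup T) (hstab : IsExponentiallyStable T)
    {C : ℝ} (hC : 0 ≤ C) (h : ∀ t : ℝ, 0 < t → ∀ w : X, t * ‖T t w‖ ≤ C * ‖K w‖) :
    ∃ D M ρ, IsAnalyticDerivFamily T K D M ρ ∧ ∀ t : ℝ, 0 < t → ‖D 1 t‖ ≤ C / t := by
  have hd := hK.denseRange hT
  obtain ⟨G, hG⟩ := exists_apply_inv_eq hd hC h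
  obtain ⟨M, ω, hM, hω, hb⟩ := hstab.exists_pos_bound
  -- `AⁿT(t) = (A T(t/n))ⁿ`; the case `n = 0` is separate because the formula would give the
  -- identity.
  set D : ℕ → ℝ → X →L[ℂ] X := fun n t => if n = 0 then T t else (-G (t / n)) ^ n with hD
  have hD0 : ∀ t, D 0 t = T t := fun t => by simp [hD]
  have hDK : ∀ n : ℕ, ∀ t : ℝ, 0 < t → ∀ x, D n t ((K ^ n) x) = (-1 : ℂ) ^ n • T t x := by
    intro n t ht x
    rcases eq_or_ne n 0 with rfl | hn
    · simp [hD]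
    · have hn' : (n : ℝ) ≠ 0 := by exact_mod_cast hn
      have hs : 0 < t / n := by positivity
      simp only [hD, if_neg hn]
      rw [hK.neg_pow_apply_pow hT hs.le (hG _ hs).1, mul_div_cancel₀ _ hn']
  have hsucc : ∀ n : ℕ, ∀ t : ℝ, 0 < t → ∀ x, D (n + 1) t (K x) = -D n t x := by
    intro n t ht
    suffices D (n + 1) t * K = -D n t from fun x => by
      simpa using congrArg (fun P : X →L[ℂ] X => P x) this
    refine ContinuousLinearMap.ext_of_denseRange_pow hd n fun x => ?_
    have h1 := hDK (n + 1) t ht x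
    rw [pow_succ' K, mul_apply_eq_comp] at h1
    rw [mul_apply_eq_comp, h1, _root_.neg_apply, hDK n t ht, pow_succ]
    simp
  have hcomm : ∀ n : ℕ, ∀ t : ℝ, 0 < t → ∀ x, K (D n t x) = D n t (K x) := by
    intro n t ht
    suffices K * D n t = D n t * K from fun x => by
      simpa using congrArg (fun P : X →L[ℂ] X => P x) this
    refine ContinuousLinearMap.ext_of_denseRange_pow hd n fun x => ?_
    have h1 : K ((K ^ n) x) = (K ^ n) (K x) :=
      congrArg (fun P : X →L[ℂ] X => P x) (Commute.self_pow K n).eq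
    rw [mul_apply_eq_comp, mul_apply_eq_comp, h1, hDK n t ht, hDK n t ht, map_smul,
      hK.comm t ht.le]
  have hadd : ∀ m n : ℕ, ∀ s t : ℝ, 0 < s → 0 < t → D (m + n) (s + t) = D m s * D n t := by
    intro m n s t hs ht
    refine ContinuousLinearMap.ext_of_denseRange_pow hd (m + n) fun x => ?_
    rw [hDK (m + n) (s + t) (by positivity), add_comm m n, pow_add K,
      mul_apply_eq_comp, mul_apply_eq_comp, hDK n t ht,
      hK.comm_pow ht.le, map_smul, hDK m s hs, smul_smul, pow_add, hT.map_add_apply hs.le ht.le]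
  -- The estimate for `n ≥ 1` is `(ρ C e)ⁿ`, so this `ρ` yields `2⁻ⁿ`; `C + 1` replaces `C` to allow
  -- `C = 0`.
  refine ⟨D, M, (2 * Real.exp 1 * (C + 1))⁻¹, ⟨by positivity, hD0, hsucc, hadd, ?_, ?_⟩, ?_⟩
  · intro n t ht x
    -- For `s > t/2`, `D n s x = T(s - t/2) D n (t/2) x` with `D n (t/2) x` in the range of `K`,
    -- where orbits are differentiable.
    have ha : 0 < t / 2 := by positivity
    have h1 : ∀ s : ℝ, t / 2 < s → ∀ m, D m s x = T (s - t / 2) (D m (t / 2) x) := by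
      intro s hs m
      have h2 := hadd 0 m (s - t / 2) (t / 2) (sub_pos.2 hs) ha
      rw [zero_add, sub_add_cancel, hD0] at h2
      rw [h2, mul_apply_eq_comp]
    have h2 : D n (t / 2) x = -K (D (n + 1) (t / 2) x) := by
      rw [hcomm _ _ ha, hsucc _ _ ha, neg_neg]
    have h3 := ((hK.hasDerivAt hT (sub_pos.2 (half_lt_self ht)) (D (n + 1) (t / 2) x)).comp_sub_const
      t (t / 2)).neg
    rw [neg_neg, ← h1 t (half_lt_self ht)] at h3
    refine h3.congr_of_eventuallyEq ?_
    filter_upwards [Ioi_mem_nhds (half_lt_self ht)] with s hs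
    rw [h1 s hs n, h2, map_neg]
    rfl
  · intro n t ht
    rcases eq_or_ne n 0 with rfl | hn
    · have h1 := hb t ht.le
      have h2 : Real.exp (-(ω * t)) ≤ 1 := Real.exp_le_one_iff.2 (by nlinarith)
      simp only [pow_zero, Nat.factorial_zero, Nat.cast_one, div_one, one_mul, mul_one, hD0]
      nlinarith
    · have hn' : (0 : ℝ) < n := by exact_mod_cast Nat.pos_of_ne_zero hn
      have h1 : ‖D n t‖ ≤ (C * n / t) ^ n := by
        simp only [hD, if_neg hn]
        refine (norm_pow_le' _ (Nat.pos_of_ne_zero hn)).trans ?_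
        rw [norm_neg]
        gcongr
        refine (hG _ (by positivity)).2.trans_eq ?_
        field_simp
      have h2 : (n : ℝ) ^ n / n.factorial ≤ Real.exp 1 ^ n := by
        rw [← Real.exp_nat_mul, mul_one]
        exact Real.pow_div_factorial_le_exp n hn'.le n
      have he := Real.exp_pos 1
      calc ((2 * Real.exp 1 * (C + 1))⁻¹ * t) ^ n / n.factorial * ‖D n t‖
          ≤ ((2 * Real.exp 1 * (C + 1))⁻¹ * t) ^ n / n.factorial * (C * n / t) ^ n := by gcongr
        _ = ((2 * Real.exp 1 * (C + 1))⁻¹ * C) ^ n * ((n : ℝ) ^ n / n.factorial) := by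
            rw [div_mul_eq_mul_div, ← mul_pow, ← mul_div_assoc (_ ^ n) (_ ^ n), ← mul_pow]
            congr 2
            field_simp
        _ ≤ ((2 * Real.exp 1 * (C + 1))⁻¹ * C) ^ n * Real.exp 1 ^ n := by gcongr
        _ = (C / (C + 1) * (1 / 2)) ^ n := by
            rw [← mul_pow]
            congr 1
            field_simp
        _ ≤ (1 * (1 / 2)) ^ n := by
            gcongr
            rw [div_le_one (by positivity)]
            linarith
        _ ≤ M * (1 / 2) ^ n := by
            rw [one_mul]
            exact le_mul_of_one_le_left (by positivity) hM
  · intro t ht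
    simpa [hD] using (hG t ht).2

end Derivatives

/-! ### Taylor extension to a sector. -/

section Extension

variable {X : Type*} [NormedAddCommGroup X] [InnerProductSpace ℂ X]
  {T : ℝ → X →L[ℂ] X} {K : X →L[ℂ] X} {D : ℕ → ℝ → X →L[ℂ] X} {M ρ : ℝ}

/-- The `n`-th term of the Taylor series at `t` of the family `D n t`. -/
noncomputable def semigroupTaylorTerm (D : ℕ → ℝ → X →L[ℂ] X) (z : ℂ) (t : ℝ) (n : ℕ) :
    X →L[ℂ] X :=
  ((z - t) ^ n / n.factorial) • D n t

/-- The Taylor series at `t` of the family `D n t`. -/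
noncomputable def semigroupTaylorSum (D : ℕ → ℝ → X →L[ℂ] X) (z : ℂ) (t : ℝ) : X →L[ℂ] X :=
  ∑' n, semigroupTaylorTerm D z t n

open scoped Classical in
/-- The extension of a semigroup to a sector by its Taylor series at the real points. -/
noncomputable def sectorExtension (D : ℕ → ℝ → X →L[ℂ] X) (z : ℂ) : X →L[ℂ] X :=
  if z = 0 then ContinuousLinearMap.id ℂ X else semigroupTaylorSum D z z.re

/-- Differentiating a Taylor polynomial in its centre telescopes to a single term. -/
lemma hasDerivAt_sum_pow_smul {E : Type*} [NormedAddCommGroup E] [NormedSpace ℂ E]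
    {d : ℕ → ℝ → E} {t : ℝ} (hd : ∀ n, HasDerivAt (d n) (d (n + 1) t) t) (z : ℂ) (N : ℕ) :
    HasDerivAt (fun s : ℝ => ∑ n ∈ Finset.range (N + 1),
      ((z - (s : ℂ)) ^ n / (n.factorial : ℂ)) • d n s)
      (((z - (t : ℂ)) ^ N / (N.factorial : ℂ)) • d (N + 1) t) t := by
  have hz : HasDerivAt (fun s : ℝ => z - (s : ℂ)) (-1) t := by
    simpa using (Complex.ofRealCLM.hasDerivAt (x := t)).const_sub z
  induction N with
  | zero => simpa using hd 0
  | succ N ih =>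
    have h1 : HasDerivAt (fun s : ℝ => (z - (s : ℂ)) ^ (N + 1) / ((N + 1).factorial : ℂ))
        (-((z - (t : ℂ)) ^ N / (N.factorial : ℂ))) t := by
      refine ((hz.pow (N + 1)).div_const _).congr_deriv ?_
      have : (N.factorial : ℂ) ≠ 0 := by exact_mod_cast N.factorial_ne_zero
      have : (N : ℂ) + 1 ≠ 0 := by exact_mod_cast N.succ_ne_zero
      rw [Nat.factorial_succ]
      push_cast
      field_simp
    have h2 := ih.add (h1.smul (hd (N + 1)))
    refine (h2.congr_deriv ?_).congr_of_eventuallyEq (Eventually.of_forall fun s => ?_)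
    · simp
    · simp only [Finset.sum_range_succ _ (N + 1)]
      rfl

namespace IsAnalyticDerivFamily

lemma norm_term_le (h : IsAnalyticDerivFamily T K D M ρ) {z : ℂ} {t : ℝ} (ht : 0 < t)
    (hz : ‖z - t‖ ≤ ρ * t) (n : ℕ) : ‖semigroupTaylorTerm D z t n‖ ≤ M * (1 / 2) ^ n := by
  refine le_trans ?_ (h.bound n t ht)
  rw [semigroupTaylorTerm, norm_smul, norm_div, norm_pow, Complex.norm_natCast]
  gcongr

lemma hasSum_bound (M : ℝ) : HasSum (fun n : ℕ => M * (1 / 2 : ℝ) ^ n) (2 * M) := by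
  rw [mul_comm]
  exact hasSum_geometric_two.mul_left M

lemma summable_norm_term (h : IsAnalyticDerivFamily T K D M ρ) {z : ℂ} {t : ℝ}
    (ht : 0 < t) (hz : ‖z - t‖ ≤ ρ * t) : Summable fun n => ‖semigroupTaylorTerm D z t n‖ :=
  (hasSum_bound M).summable.of_nonneg_of_le (fun _ => norm_nonneg _) (h.norm_term_le ht hz)

lemma norm_sum_le (h : IsAnalyticDerivFamily T K D M ρ) {z : ℂ} {t : ℝ} (ht : 0 < t)
    (hz : ‖z - t‖ ≤ ρ * t) : ‖semigroupTaylorSum D z t‖ ≤ 2 * M :=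
  tsum_of_norm_bounded (hasSum_bound M) (h.norm_term_le ht hz)

variable [CompleteSpace X]

lemma hasSum_apply (h : IsAnalyticDerivFamily T K D M ρ) {z : ℂ} {t : ℝ} (ht : 0 < t)
    (hz : ‖z - t‖ ≤ ρ * t) (x : X) :
    HasSum (fun n => semigroupTaylorTerm D z t n x) (semigroupTaylorSum D z t x) := by
  have hs : HasSum (semigroupTaylorTerm D z t) (semigroupTaylorSum D z t) :=
    (h.summable_norm_term ht hz).of_norm.hasSum
  exact hs.mapL (ContinuousLinearMap.apply ℂ X x)

/-- The sum of the Taylor series does not depend on its centre. -/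
lemma sum_eq_sum (h : IsAnalyticDerivFamily T K D M ρ) {z : ℂ} {s t : ℝ} (hs : 0 < s)
    (hzs : ‖z - s‖ ≤ ρ * s) (ht : 0 < t) (hzt : ‖z - t‖ ≤ ρ * t) :
    semigroupTaylorSum D z s = semigroupTaylorSum D z t := by
  ext x
  -- The centres whose closed disc contains `z` form a convex set, so the mean value inequality
  -- applies between `s` and `t`. Staying above `m = min s t` keeps the factor `1/(ρ r)` bounded.
  set U : Set ℝ := Ioi 0 ∩ {r | ‖z - r‖ - ρ * r ≤ 0} with hU
  have hUc : Convex ℝ U := by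
    refine (convex_Ioi 0).inter ?_
    have h1 : ConvexOn ℝ univ (fun r : ℝ => ‖z - r‖ - ρ * r) := by
      refine ⟨convex_univ, fun a _ b _ p q hp hq hpq => ?_⟩
      have h2 : z - ((p • a + q • b : ℝ) : ℂ) = (p : ℂ) * (z - a) + (q : ℂ) * (z - b) := by
        have : (p : ℂ) + q = 1 := by exact_mod_cast hpq
        simp only [smul_eq_mul, Complex.ofReal_add, Complex.ofReal_mul]
        linear_combination (-z) * this
      have h3 : ‖z - ((p • a + q • b : ℝ) : ℂ)‖ ≤ p * ‖z - a‖ + q * ‖z - b‖ := by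
        rw [h2]
        refine (norm_add_le _ _).trans_eq ?_
        rw [norm_mul, norm_mul, Complex.norm_real, Complex.norm_real, Real.norm_of_nonneg hp,
          Real.norm_of_nonneg hq]
      simp only [smul_eq_mul] at h3 ⊢
      linarith
    simpa using h1.convex_le 0
  have hsU : s ∈ U := ⟨hs, by simpa using hzs⟩
  have htU : t ∈ U := ⟨ht, by simpa using hzt⟩
  set m : ℝ := min s t with hm
  have hm0 : 0 < m := lt_min hs ht
  set V : Set ℝ := U ∩ Ici m with hV
  have hVc : Convex ℝ V := hUc.inter (convex_Ici m)
  have hbound : ∀ N : ℕ,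
      ‖(∑ n ∈ Finset.range (N + 1), semigroupTaylorTerm D z t n x) -
        ∑ n ∈ Finset.range (N + 1), semigroupTaylorTerm D z s n x‖ ≤
      ((N + 1 : ℝ) / (ρ * m) * (M * (1 / 2) ^ (N + 1)) * ‖x‖) * ‖t - s‖ := by
    intro N
    refine hVc.norm_image_sub_le_of_norm_hasDerivWithin_le
      (f := fun r : ℝ => ∑ n ∈ Finset.range (N + 1), semigroupTaylorTerm D z r n x)
      (f' := fun r : ℝ => ((z - (r : ℂ)) ^ N / (N.factorial : ℂ)) • D (N + 1) r x)
      (fun r hr => ?_) (fun r hr => ?_) ⟨hsU, min_le_left s t⟩ ⟨htU, min_le_right s t⟩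
    · exact (hasDerivAt_sum_pow_smul (d := fun n r => D n r x)
        (fun n => h.hasDerivAt n r hr.1.1 x) z N).hasDerivWithinAt
    · have hr0 : 0 < r := hr.1.1
      have hrz : ‖z - r‖ ≤ ρ * r := by simpa using hr.1.2
      have hmr : m ≤ r := hr.2
      have hρ := h.radius_pos
      have hb := h.bound (N + 1) r hr0
      have hM : 0 ≤ M * (1 / 2) ^ (N + 1) := le_trans (by positivity) hb
      rw [norm_smul, norm_div, norm_pow, Complex.norm_natCast]
      calc ‖z - (r : ℂ)‖ ^ N / N.factorial * ‖D (N + 1) r x‖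
          ≤ (ρ * r) ^ N / N.factorial * (‖D (N + 1) r‖ * ‖x‖) := by
            gcongr
            exact (D (N + 1) r).le_opNorm x
        _ = (N + 1 : ℝ) / (ρ * r) *
            ((ρ * r) ^ (N + 1) / (N + 1).factorial * ‖D (N + 1) r‖) * ‖x‖ := by
            rw [Nat.factorial_succ]
            push_cast
            field_simp
            rw [pow_succ]
            ring
        _ ≤ (N + 1 : ℝ) / (ρ * m) * (M * (1 / 2) ^ (N + 1)) * ‖x‖ := by gcongr
  have hlim : Tendsto (fun N : ℕ =>
      ((N + 1 : ℝ) / (ρ * m) * (M * (1 / 2) ^ (N + 1)) * ‖x‖) * ‖t - s‖) atTop (𝓝 0) := by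
    have h1 : Tendsto (fun n : ℕ => (n : ℝ) * (1 / 2 : ℝ) ^ n) atTop (𝓝 0) :=
      tendsto_self_mul_const_pow_of_lt_one (by norm_num) (by norm_num)
    have h2 := ((tendsto_add_atTop_iff_nat 1).2 h1).const_mul (M / (ρ * m) * ‖x‖ * ‖t - s‖)
    rw [mul_zero] at h2
    refine h2.congr fun N => ?_
    push_cast
    ring
  have h3 := ((tendsto_add_atTop_iff_nat 1).2 (h.hasSum_apply ht hzt x).tendsto_sum_nat).sub
    ((tendsto_add_atTop_iff_nat 1).2 (h.hasSum_apply hs hzs x).tendsto_sum_nat)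
  have h4 := tendsto_nhds_unique h3 (squeeze_zero_norm hbound hlim)
  exact (sub_eq_zero.1 h4).symm

lemma differentiableAt_sum (h : IsAnalyticDerivFamily T K D M ρ) {z : ℂ} {t : ℝ} (ht : 0 < t)
    (hz : ‖z - t‖ < ρ * t) : DifferentiableAt ℂ (fun w => semigroupTaylorSum D w t) z := by
  have hU : IsOpen (Metric.ball (t : ℂ) (ρ * t)) := Metric.isOpen_ball
  refine (Complex.differentiableOn_tsum_of_summable_norm (hasSum_bound M).summable
    (F := fun n w => semigroupTaylorTerm D w t n) (fun n => ?_) hU (fun n w hw => ?_)).differentiableAt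
    (hU.mem_nhds (by rwa [mem_ball_iff_norm]))
  · unfold semigroupTaylorTerm
    fun_prop
  · exact h.norm_term_le ht (mem_ball_iff_norm.1 hw).le n

/-- Cauchy product, then `D m s * D n t = D (m + n) (s + t)` and the binomial theorem. -/
lemma sum_mul_sum (h : IsAnalyticDerivFamily T K D M ρ) {z w : ℂ} {s t : ℝ} (hs : 0 < s)
    (hzs : ‖z - s‖ ≤ ρ * s) (ht : 0 < t) (hwt : ‖w - t‖ ≤ ρ * t) :
    semigroupTaylorSum D (z + w) (s + t) = semigroupTaylorSum D z s * semigroupTaylorSum D w t := by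
  unfold semigroupTaylorSum
  rw [tsum_mul_tsum_eq_tsum_sum_antidiagonal_of_summable_norm (h.summable_norm_term hs hzs)
    (h.summable_norm_term ht hwt)]
  refine tsum_congr fun n => ?_
  have h1 : ∀ p ∈ Finset.HasAntidiagonal.antidiagonal n, semigroupTaylorTerm D z s p.1 * semigroupTaylorTerm D w t p.2
      = ((n.choose p.1 * ((z - s) ^ p.1 * (w - t) ^ p.2)) / n.factorial : ℂ) • D n (s + t) := by
    intro p hp
    rw [Finset.HasAntidiagonal.mem_antidiagonal] at hp
    subst hp
    rw [semigroupTaylorTerm, semigroupTaylorTerm, smul_mul_smul_comm, h.add _ _ _ _ hs ht]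
    congr 1
    have h2 : ((p.1 + p.2).factorial : ℂ)
        = (p.1 + p.2).choose p.1 * p.1.factorial * p.2.factorial := by
      rw [← Nat.add_choose_mul_factorial_mul_factorial p.1 p.2, Nat.choose_symm_add]
      push_cast
      ring
    have h3 : ((p.1 + p.2).choose p.1 : ℂ) ≠ 0 := by
      exact_mod_cast (Nat.choose_pos (Nat.le_add_right _ _)).ne'
    have h4 : (p.1.factorial : ℂ) ≠ 0 := by exact_mod_cast p.1.factorial_ne_zero
    have h5 : (p.2.factorial : ℂ) ≠ 0 := by exact_mod_cast p.2.factorial_ne_zero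
    rw [h2]
    field_simp
  rw [Finset.sum_congr rfl h1, ← Finset.sum_smul, ← Finset.sum_div, semigroupTaylorTerm]
  congr 2
  have h2 : z + w - ((s + t : ℝ) : ℂ) = (z - s) + (w - t) := by push_cast; ring
  rw [h2, (Commute.all (z - (s : ℂ)) (w - t)).add_pow']
  simp [nsmul_eq_mul]

/-- On the range of `K` one derivative is absorbed, which frees a factor `z - t`; this gives strong
continuity at `0` on a dense set. -/
lemma norm_sum_apply_inv_sub_le (h : IsAnalyticDerivFamily T K D M ρ) {z : ℂ} {t : ℝ}
    (ht : 0 < t) (hz : ‖z - t‖ ≤ ρ * t) (w : X) :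
    ‖semigroupTaylorSum D z t (K w) - T t (K w)‖ ≤ 2 * (‖z - t‖ * ‖w‖ * M) := by
  have h1 := (hasSum_nat_add_iff' 1).2 (h.hasSum_apply ht hz (K w))
  have h0 : semigroupTaylorTerm D z t 0 (K w) = T t (K w) := by
    simp [semigroupTaylorTerm, h.zero]
  rw [Finset.sum_range_one, h0] at h1
  refine h1.norm_le_of_bounded (hasSum_bound (‖z - t‖ * ‖w‖ * M)) fun n => ?_
  have h2 : semigroupTaylorTerm D z t (n + 1) (K w)
      = (-((z - t) / (n + 1 : ℕ)) : ℂ) • semigroupTaylorTerm D z t n w := by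
    simp only [semigroupTaylorTerm, _root_.smul_apply, h.succ_apply_inv n t ht, smul_smul,
      smul_neg, ← neg_smul]
    congr 1
    rw [Nat.factorial_succ]
    push_cast
    rw [pow_succ, neg_mul, div_mul_div_comm]
    ring
  rw [h2, norm_smul, norm_neg, norm_div, Complex.norm_natCast]
  calc ‖z - t‖ / (n + 1 : ℕ) * ‖semigroupTaylorTerm D z t n w‖
      ≤ ‖z - t‖ / 1 * ((M * (1 / 2) ^ n) * ‖w‖) := by
        gcongr
        · exact_mod_cast Nat.le_add_left 1 n
        · exact ContinuousLinearMap.le_of_opNorm_le _ (h.norm_term_le ht hz n) w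
    _ = _ := by ring

end IsAnalyticDerivFamily

/-- `‖z - Re z‖ = |Im z| = |tan (arg z)| Re z`. -/
lemma re_pos_and_norm_sub_re_lt_of_mem_openSector {ρ : ℝ} {z : ℂ}
    (hz : z ∈ openSector (Real.arctan ρ)) : 0 < z.re ∧ ‖z - z.re‖ < ρ * z.re := by
  obtain ⟨hz0, hz⟩ := hz
  have h1 := hz.trans (Real.arctan_lt_pi_div_two ρ)
  have hre : 0 < z.re := (Complex.abs_arg_lt_pi_div_two_iff.1 h1).resolve_right hz0
  refine ⟨hre, ?_⟩
  have h2 : z - z.re = z.im * Complex.I := by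
    nth_rewrite 1 [← Complex.re_add_im z]
    ring
  rw [h2, norm_mul, Complex.norm_I, mul_one, Complex.norm_real, Real.norm_eq_abs]
  have h3 : Real.tan |z.arg| < ρ := by
    rw [← Real.tan_arctan ρ]
    exact Real.tan_lt_tan_of_lt_of_lt_pi_div_two
      (by linarith [abs_nonneg z.arg, Real.pi_pos]) (Real.arctan_lt_pi_div_two ρ) hz
  have h4 : |Real.tan z.arg| ≤ Real.tan |z.arg| := by
    rcases le_total 0 z.arg with h | h
    · rw [abs_of_nonneg h, abs_of_nonneg]
      exact Real.tan_nonneg_of_nonneg_of_le_pi_div_two h (by rw [abs_of_nonneg h] at h1; exact h1.le)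
    · rw [abs_of_nonpos h] at h1 ⊢
      rw [← abs_neg, ← Real.tan_neg, abs_of_nonneg]
      exact Real.tan_nonneg_of_nonneg_of_le_pi_div_two (by linarith) h1.le
  rw [Complex.tan_arg, abs_div, abs_of_pos hre] at h4
  rw [← div_lt_iff₀ hre]
  exact h4.trans_lt h3

lemma IsAnalyticDerivFamily.isBoundedAnalyticSemigroup [CompleteSpace X]
    (h : IsAnalyticDerivFamily T K D M ρ) (hT : IsC0Semigroup T) (hd : DenseRange K) :
    IsBoundedAnalyticSemigroup (Real.arctan ρ) (sectorExtension D) := by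
  have hS : ∀ z ∈ openSector (Real.arctan ρ),
      sectorExtension D z = semigroupTaylorSum D z z.re := fun z hz => if_neg hz.1
  have hsub : ∀ δ' : ℝ, δ' < Real.arctan ρ → openSector δ' ⊆ openSector (Real.arctan ρ) :=
    fun δ' hδ z hz => ⟨hz.1, hz.2.trans hδ⟩
  have hbd : ∀ z ∈ openSector (Real.arctan ρ), ‖sectorExtension D z‖ ≤ 2 * M := fun z hz => by
    obtain ⟨h1, h2⟩ := re_pos_and_norm_sub_re_lt_of_mem_openSector hz
    rw [hS z hz]
    exact h.norm_sum_le h1 h2.le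
  refine ⟨Real.arctan_pos.2 h.radius_pos, (Real.arctan_lt_pi_div_two ρ).le, if_pos rfl, ?_, ?_, ?_,
    fun δ' _ hδ => ⟨2 * M, fun z hz => hbd z (hsub δ' hδ hz)⟩⟩
  · intro z hz w hw
    obtain ⟨h1, h2⟩ := re_pos_and_norm_sub_re_lt_of_mem_openSector hz
    obtain ⟨h3, h4⟩ := re_pos_and_norm_sub_re_lt_of_mem_openSector hw
    have h5 : z + w ≠ 0 := fun h0 => by
      have := congrArg Complex.re h0
      simp at this
      linarith
    rw [hS z hz, hS w hw, sectorExtension, if_neg h5, Complex.add_re,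
      h.sum_mul_sum h1 h2.le h3 h4.le]
    rfl
  · intro z hz
    obtain ⟨h1, h2⟩ := re_pos_and_norm_sub_re_lt_of_mem_openSector hz
    refine (h.differentiableAt_sum h1 h2).differentiableWithinAt.congr_of_eventuallyEq ?_
      (hS z hz)
    -- The centre `w.re` moves with `w`; near `z` it may be frozen at `z.re`, since the sum is
    -- independent of the centre.
    have hev : ∀ᶠ w : ℂ in 𝓝 z, ‖w - z.re‖ < ρ * z.re :=
      ContinuousAt.eventually_lt (by fun_prop) continuousAt_const h2
    filter_upwards [self_mem_nhdsWithin, mem_nhdsWithin_of_mem_nhds hev] with w hw hwz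
    obtain ⟨h3, h4⟩ := re_pos_and_norm_sub_re_lt_of_mem_openSector hw
    rw [hS w hw]
    exact h.sum_eq_sum h3 h4.le h1 hwz.le
  · intro δ' _ hδ x
    have hM : 0 ≤ M := by
      have := h.bound 0 1 one_pos
      simp only [pow_zero, mul_one] at this
      exact le_trans (by positivity) this
    have hl : 𝓝[openSector δ'] (0 : ℂ) ≤ 𝓝[openSector (Real.arctan ρ)] 0 :=
      nhdsWithin_mono _ (hsub δ' hδ)
    refine Tendsto.mono_left ?_ hl
    have hre : Tendsto (fun z : ℂ => z.re) (𝓝[openSector (Real.arctan ρ)] 0) (𝓝[>] 0) := by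
      refine tendsto_nhdsWithin_iff.2
        ⟨(Complex.continuous_re.tendsto' 0 0 rfl).mono_left nhdsWithin_le_nhds, ?_⟩
      filter_upwards [self_mem_nhdsWithin] with z hz
      exact (re_pos_and_norm_sub_re_lt_of_mem_openSector hz).1
    have hrange : ∀ w : X, Tendsto (fun z : ℂ => sectorExtension D z (K w))
        (𝓝[openSector (Real.arctan ρ)] 0) (𝓝 (K w)) := by
      intro w
      have h1 : Tendsto (fun z : ℂ => T z.re (K w)) (𝓝[openSector (Real.arctan ρ)] 0)
          (𝓝 (K w)) := (hT.tendsto_zero (K w)).comp hre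
      have h2 : Tendsto (fun z : ℂ => 2 * (‖z - z.re‖ * ‖w‖ * M))
          (𝓝[openSector (Real.arctan ρ)] 0) (𝓝 0) := by
        have h3 : Continuous fun z : ℂ => 2 * (‖z - z.re‖ * ‖w‖ * M) := by fun_prop
        exact (h3.tendsto' 0 0 (by simp)).mono_left nhdsWithin_le_nhds
      have h4 : Tendsto (fun z : ℂ => sectorExtension D z (K w) - T z.re (K w))
          (𝓝[openSector (Real.arctan ρ)] 0) (𝓝 0) := by
        refine squeeze_zero_norm' ?_ h2
        filter_upwards [self_mem_nhdsWithin] with z hz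
        obtain ⟨h5, h6⟩ := re_pos_and_norm_sub_re_lt_of_mem_openSector hz
        rw [hS z hz]
        exact h.norm_sum_apply_inv_sub_le h5 h6.le w
      simpa using h4.add h1
    rw [Metric.tendsto_nhds]
    intro ε hε
    -- The uniform bound `2M` and the extra `‖x - K w‖` together cost `(2M + 1) ‖x - K w‖ < ε/2`.
    obtain ⟨w, hw⟩ := hd.exists_dist_lt x (ε := ε / (2 * (2 * M + 1))) (by positivity)
    filter_upwards [self_mem_nhdsWithin, Metric.tendsto_nhds.1 (hrange w) (ε / 2) (by positivity)]
      with z hz hzw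
    rw [dist_eq_norm] at hw hzw ⊢
    have h1 : sectorExtension D z x - x
        = sectorExtension D z (x - K w) + (sectorExtension D z (K w) - K w) - (x - K w) := by
      rw [map_sub]; abel
    have h2 : ‖sectorExtension D z (x - K w)‖ ≤ 2 * M * ‖x - K w‖ :=
      ContinuousLinearMap.le_of_opNorm_le _ (hbd z hz) _
    have h3 : (2 * M + 1) * ‖x - K w‖ < ε / 2 := by
      rw [lt_div_iff₀ (by positivity)] at hw
      linarith
    rw [h1]
    have h4 := norm_sub_le (sectorExtension D z (x - K w) + (sectorExtension D z (K w) - K w))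
      (x - K w)
    have h5 := norm_add_le (sectorExtension D z (x - K w)) (sectorExtension D z (K w) - K w)
    linarith

lemma IsAnalyticDerivFamily.sectorExtension_ofReal (h : IsAnalyticDerivFamily T K D M ρ) {t : ℝ}
    (ht : 0 < t) : sectorExtension D (t : ℂ) = T t := by
  have h1 : (t : ℂ) ≠ 0 := by exact_mod_cast ht.ne'
  rw [sectorExtension, if_neg h1, semigroupTaylorSum, tsum_eq_single 0]
  · simp [semigroupTaylorTerm, h.zero]
  · intro n hn
    simp [semigroupTaylorTerm, hn]

end Extension

/-! ### The main theorem. -/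

theorem mainTheorem8 {X : Type*} [NormedAddCommGroup X] [InnerProductSpace ℂ X] [CompleteSpace X]
    (A : X →ₗ.[ℂ] X) (T : ℝ → X →L[ℂ] X)
    (hT : IsC0Semigroup T) (hA : IsGenerator A T) (hstab : IsExponentiallyStable T)
    (hadm : IsAdmissible T A (negGenSqrt T))
    (hadm_adj : IsAdmissible (fun t : ℝ => ContinuousLinearMap.adjoint (T t)) A.adjoint
      (negGenSqrt (fun t : ℝ => ContinuousLinearMap.adjoint (T t)))) :
    (∃ M : ℝ, ∀ t : ℝ, 0 < t → ∀ x : X, ∃ h : T t x ∈ A.domain,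
      ‖A ⟨T t x, h⟩‖ ≤ M / t * ‖x‖) ∧
    GeneratesBoundedAnalyticSemigroup A := by
  obtain ⟨K, hK₀⟩ := hT.exists_rpowIntegral hstab (s := 0) (by norm_num)
  have hKi : ∀ x, K x = ∫ t in Ioi (0 : ℝ), T t x := fun x => by simpa using hK₀ x
  have hK := hT.isNegInverseGenerator hstab hKi
  obtain ⟨C, hC, hCT⟩ := IsNegInverseGenerator.mul_norm_le_of_isAdmissible hT hA hstab hKi hadm
    hadm_adj
  obtain ⟨D, M, ρ, hD, hD1⟩ := hK.exists_isAnalyticDerivFamily hT hstab hC hCT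
  refine ⟨⟨C, fun t ht x => ?_⟩, Real.arctan ρ, sectorExtension D,
    hD.isBoundedAnalyticSemigroup hT (hK.denseRange hT), fun x y => ?_⟩
  · have hmem : (T t x, D 1 t x) ∈ A.graph := by
      rw [hA]
      -- The orbit `T(·) x` is differentiable at `t`, and its right difference quotient there is
      -- that of `T(·) T(t) x` at `0`.
      have h1 := (hasDerivAt_iff_tendsto_slope_zero.1 (hD.hasDerivAt 0 t ht x))
      refine (h1.mono_left (nhdsWithin_mono _ fun r hr => ne_of_gt hr)).congr' ?_
      filter_upwards [self_mem_nhdsWithin] with r hr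
      have hr' : (0 : ℝ) ≤ r := le_of_lt hr
      rw [hD.zero, hD.zero, add_comm, hT.map_add_apply hr' ht.le]
    refine ⟨LinearPMap.mem_domain_of_mem_graph hmem, ?_⟩
    obtain ⟨y, hy, hAy⟩ := (LinearPMap.mem_graph_iff _).1 hmem
    have h2 : A ⟨T t x, LinearPMap.mem_domain_of_mem_graph hmem⟩ = D 1 t x :=
      (congrArg A (Subtype.ext hy.symm)).trans hAy
    rw [h2]
    exact (D 1 t).le_of_opNorm_le (hD1 t ht) x
  · rw [hA]
    refine tendsto_congr' ?_
    filter_upwards [self_mem_nhdsWithin] with r hr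
    rw [hD.sectorExtension_ofReal hr]
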